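/- There are absolute constants $c_1,c_2>0$ such that the following holds for every $n\in\mathbb N$, all real numbers $a_{i,j}$ and all independent standard Gaussian random variables $g_{i,j}$, $i,j=1,\dots,n$. For $x\in\mathbb R^n$ write $\|x\|_2$ for the Euclidean norm and $\|x\|_\infty=\max_k|x_k|$, and define for $s\ge 0$ $$ N_x(s)=\begin{cases} s\,\|x\|_\infty\, e^{-\frac{1}{s^2\|x\|_\infty^2}}, & s<\frac1{\|x\|_2},\\[1ex] \frac{\|x\|_\infty}{\|x\|_2}\,e^{-\frac{\|x\|_2^2}{\|x\|_\infty^2}}+\frac3e\,\|x\|_2\left(s-\frac1{\|x\|_2}\right), & s\ge\frac1{\|x\|_2}, \end{cases} $$ where $N_x(0)=0$, and $N_x(s)=0$ for all $s$ if $x=0$. Let $N_i=N_x$ for the $i$-th row $x=(a_{i,j})_{j=1}^n$ and $\widetilde N_j=N_x$ for the $j$-th column $x=(a_{i,j})_{i=1}^n$. Then all $N_i$ and $\widetilde N_j$ are Orlicz functions (convex functions $[0,\infty)\to[0,\infty)$ vanishing at $0$), the random variable $\max_{i}\|(a_{i,j}g_{i,j})_{j=1}^n\|_2+\max_{j}\|(a_{i,j}g_{i,j})_{i=1}^n\|_2$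 is integrable, and $$ c_1\left(\|(1)_{i=1}^n\|_{(N_i)_i}+\|(1)_{j=1}^n\|_{(\widetilde N_j)_j}\right) \le \mathbb E\left(\max_{1\le i\le n}\|(a_{i,j}g_{i,j})_{j=1}^n\|_2+\max_{1\le j\le n}\|(a_{i,j}g_{i,j})_{i=1}^n\|_2\right) \le c_2\left(\|(1)_{i=1}^n\|_{(N_i)_i}+\|(1)_{j=1}^n\|_{(\widetilde N_j)_j}\right), $$ where for Orlicz functions $M_1,\dots,M_n$ the Musielak–Orlicz norm of $y\in\mathbb R^n$ is $\|y\|_{(M_i)_i}=\inf\{t>0 : \sum_{i=1}^n M_i(|y_i|/t)\le 1\}$. -/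

import Mathlib

open MeasureTheory ProbabilityTheory

/-- An Orlicz function: a convex `M : [0, ∞) → [0, ∞)` with `M 0 = 0`. It is represented by a
function on `ℝ`, of which only the values on `[0, ∞)` matter. -/
structure IsOrliczFunction (M : ℝ → ℝ) : Prop where
  nonneg : ∀ s, 0 ≤ s → 0 ≤ M s
  map_zero : M 0 = 0
  convexOn : ConvexOn ℝ (Set.Ici 0) M

/-- The Musielak-Orlicz norm `‖x‖_{(M i)_i} = inf {t > 0 | ∑ i, M i (|x i| / t) ≤ 1}`. -/
noncomputable def musielakOrliczNorm {n : ℕ} (M : Fin n → ℝ → ℝ) (x : Fin n → ℝ) : ℝ :=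
  sInf {t : ℝ | 0 < t ∧ ∑ i, M i (|x i| / t) ≤ 1}

/-- The Euclidean norm of a vector. -/
noncomputable def l2Norm {n : ℕ} (x : Fin n → ℝ) : ℝ :=
  ‖(WithLp.toLp 2 x : EuclideanSpace ℝ (Fin n))‖

/-- The largest absolute value of the entries of a vector. -/
noncomputable def maxAbs {n : ℕ} (x : Fin n → ℝ) : ℝ :=
  ⨆ i, |x i|

/-- The explicit Orlicz function of a vector `x` (a row or a column of coefficients), evaluated at
`s ≥ 0`. At `s = 0`, and for every `s` if `x = 0`, the formula gives `0`, which is the value under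
the usual conventions `1 / 0 = ∞` and `exp (-∞) = 0`. -/
noncomputable def vecOrlicz {n : ℕ} (x : Fin n → ℝ) (s : ℝ) : ℝ :=
  if s < 1 / l2Norm x then
    s * maxAbs x * Real.exp (-(1 / (s ^ 2 * maxAbs x ^ 2)))
  else
    maxAbs x / l2Norm x * Real.exp (-(l2Norm x ^ 2 / maxAbs x ^ 2))
      + 3 / Real.exp 1 * l2Norm x * (s - 1 / l2Norm x)

/-- The Orlicz function `N i`, built from the `i`-th row of the coefficients. -/
noncomputable def rowOrlicz {n : ℕ} (a : Fin n → Fin n → ℝ) (i : Fin n) : ℝ → ℝ :=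
  vecOrlicz fun j => a i j

/-- The Orlicz function `Ñ j`, built from the `j`-th column of the coefficients. -/
noncomputable def colOrlicz {n : ℕ} (a : Fin n → Fin n → ℝ) (j : Fin n) : ℝ → ℝ :=
  vecOrlicz fun i => a i j

/-- The largest Euclidean norm of a row plus the largest Euclidean norm of a column. -/
noncomputable def maxRowAddMaxCol {n : ℕ} (b : Fin n → Fin n → ℝ) : ℝ :=
  (⨆ i, l2Norm fun j => b i j) + ⨆ j, l2Norm fun i => b i j

/-! Expectation splits the sum, and columns are rows of the transpose, so only the maximal row norm
`R` matters. For `t ≥ ‖x‖₂`, `N_x(1/t) = (m/t) exp(-t²/m²)` with `m = ‖x‖_∞`: up to constants in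
value and scale, it controls how much a row exceeds `t`, a deviation governed by its largest
coefficient.

Upper bound: if `t` is admissible in the norm, the linear branch of `N_i` forces every row to have
norm at most `T = 2t`. A chi-square exponential moment bounds each mean excess over `3T` by `T
N_i(1/T)` (`integral_max_sub_le`), so `E R ≤ 3T + T = 8t`.

Lower bound: any `t` above a constant times `E R` is admissible. `E R` dominates each row norm
(`mul_l2Norm_le_integral`), so `N_i(1/t)` is in its exponential branch, where a multiple of it
bounds from below the probability that the largest-coefficient entry of row `i` exceeds `t`. These
entries are independent; were `∑ N_i(1/t) > 1`, then `R ≥ t` would have probability bounded below,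
contradicting Markov. -/

lemma l2Norm_eq_sqrt {n : ℕ} (x : Fin n → ℝ) : l2Norm x = √(∑ i, x i ^ 2) := by
  simp [l2Norm, EuclideanSpace.norm_eq]

lemma l2Norm_nonneg {n : ℕ} (x : Fin n → ℝ) : 0 ≤ l2Norm x := norm_nonneg _

lemma l2Norm_sq {n : ℕ} (x : Fin n → ℝ) : l2Norm x ^ 2 = ∑ i, x i ^ 2 := by
  rw [l2Norm_eq_sqrt, Real.sq_sqrt (Finset.sum_nonneg fun i _ => sq_nonneg _)]

lemma abs_le_l2Norm {n : ℕ} (x : Fin n → ℝ) (i : Fin n) : |x i| ≤ l2Norm x := by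
  rw [l2Norm_eq_sqrt]
  refine Real.abs_le_sqrt ?_
  exact Finset.single_le_sum (f := fun i => x i ^ 2) (fun i _ => sq_nonneg _) (Finset.mem_univ i)

lemma abs_le_maxAbs {n : ℕ} (x : Fin n → ℝ) (i : Fin n) : |x i| ≤ maxAbs x :=
  le_ciSup (f := fun i => |x i|) (Set.finite_range _).bddAbove i

lemma maxAbs_nonneg {n : ℕ} (x : Fin n → ℝ) : 0 ≤ maxAbs x :=
  Real.iSup_nonneg fun _ => abs_nonneg _

lemma maxAbs_le_l2Norm {n : ℕ} (x : Fin n → ℝ) : maxAbs x ≤ l2Norm x :=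
  Real.iSup_le (abs_le_l2Norm x) (l2Norm_nonneg x)

lemma exists_abs_eq_maxAbs {n : ℕ} [Nonempty (Fin n)] (x : Fin n → ℝ) : ∃ i, |x i| = maxAbs x :=
  exists_eq_ciSup_of_finite (f := fun i => |x i|)

lemma l2Norm_eq_zero_of_maxAbs {n : ℕ} {x : Fin n → ℝ} (h : maxAbs x = 0) : l2Norm x = 0 := by
  rw [l2Norm_eq_sqrt, Finset.sum_eq_zero, Real.sqrt_zero]
  intro i _
  have h1 := abs_le_maxAbs x i
  rw [h] at h1
  simpa using h1

lemma maxAbs_pos {n : ℕ} {x : Fin n → ℝ} (h : 0 < l2Norm x) : 0 < maxAbs x :=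
  (maxAbs_nonneg x).lt_of_ne fun h0 => h.ne' (l2Norm_eq_zero_of_maxAbs h0.symm)

/-! ### Convexity of the profile `u exp(-1/u²)` -/

lemma hasDerivAt_exp_neg_one_div_sq {u : ℝ} (hu : u ≠ 0) :
    HasDerivAt (fun u : ℝ => Real.exp (-(1 / u ^ 2))) (2 / u ^ 3 * Real.exp (-(1 / u ^ 2))) u := by
  have h := ((((hasDerivAt_pow 2 u).inv (pow_ne_zero 2 hu)).neg).exp)
  simp only [one_div]
  convert h using 1
  simp only [Pi.neg_apply, Pi.inv_apply]
  field_simp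
  norm_num
  ring

lemma hasDerivAt_mul_exp_neg_one_div_sq {u : ℝ} (hu : u ≠ 0) :
    HasDerivAt (fun u : ℝ => u * Real.exp (-(1 / u ^ 2)))
      ((1 + 2 / u ^ 2) * Real.exp (-(1 / u ^ 2))) u := by
  refine ((hasDerivAt_id' u).fun_mul (hasDerivAt_exp_neg_one_div_sq hu)).congr_deriv ?_
  field_simp

/-- The second derivative has the sign of `2 - u²`. Any endpoint strictly between `1` and `√2` would
do; it makes `u = 1` an interior point. -/
lemma convexOn_mul_exp_neg_one_div_sq :
    ConvexOn ℝ (Set.Ioo 0 (6 / 5)) (fun u : ℝ => u * Real.exp (-(1 / u ^ 2))) := by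
  refine convexOn_of_hasDerivWithinAt2_nonneg
    (f' := fun u => (1 + 2 / u ^ 2) * Real.exp (-(1 / u ^ 2)))
    (f'' := fun u => (4 / u ^ 5 - 2 / u ^ 3) * Real.exp (-(1 / u ^ 2)))
    (convex_Ioo _ _) ?_ ?_ ?_ ?_
  · exact fun u hu => (hasDerivAt_mul_exp_neg_one_div_sq hu.1.ne').continuousAt.continuousWithinAt
  · intro u hu
    rw [interior_Ioo] at hu
    exact (hasDerivAt_mul_exp_neg_one_div_sq hu.1.ne').hasDerivWithinAt
  · intro u hu
    rw [interior_Ioo] at hu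
    have h1 := (((hasDerivAt_pow 2 u).fun_inv (pow_ne_zero 2 hu.1.ne')).const_mul 2).const_add 1
    have h2 := h1.fun_mul (hasDerivAt_exp_neg_one_div_sq hu.1.ne')
    have hu0 : u ≠ 0 := hu.1.ne'
    refine (h2.congr_deriv ?_).hasDerivWithinAt
    field_simp
    norm_num
    ring
  · intro u hu
    rw [interior_Ioo] at hu
    obtain ⟨h0, h1⟩ := hu
    have : 4 / u ^ 5 - 2 / u ^ 3 = (2 * (2 - u ^ 2)) / u ^ 5 := by field_simp; ring
    rw [this]
    have : 0 ≤ 2 - u ^ 2 := by nlinarith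
    positivity

/-- The tangent of `u ↦ u e^{-1/u²}` at a point of `(0, 1]` lies below the graph on `[0, 1]`. -/
lemma tangent_le_mul_exp_neg_one_div_sq {u v : ℝ} (hu : 0 < u) (hu1 : u ≤ 1) (hv : 0 ≤ v)
    (hv1 : v ≤ 1) :
    u * Real.exp (-(1 / u ^ 2)) + (1 + 2 / u ^ 2) * Real.exp (-(1 / u ^ 2)) * (v - u)
      ≤ v * Real.exp (-(1 / v ^ 2)) := by
  rcases hv.eq_or_lt with rfl | hv
  · have : u * Real.exp (-(1 / u ^ 2)) + (1 + 2 / u ^ 2) * Real.exp (-(1 / u ^ 2)) * (0 - u)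
      = -(2 / u * Real.exp (-(1 / u ^ 2))) := by field_simp; ring
    rw [this, zero_mul]
    have : 0 < 2 / u * Real.exp (-(1 / u ^ 2)) := by positivity
    linarith
  · have hmu : u ∈ Set.Ioo (0 : ℝ) (6 / 5) := ⟨hu, by linarith⟩
    have hmv : v ∈ Set.Ioo (0 : ℝ) (6 / 5) := ⟨hv, by linarith⟩
    have hd := hasDerivAt_mul_exp_neg_one_div_sq hu.ne'
    rcases lt_trichotomy u v with h | rfl | h
    · have := convexOn_mul_exp_neg_one_div_sq.le_slope_of_hasDerivAt hmu hmv h hd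
      rw [slope_def_field, le_div_iff₀ (sub_pos.2 h)] at this
      linarith
    · simp
    · have := convexOn_mul_exp_neg_one_div_sq.slope_le_of_hasDerivAt hmv hmu h hd
      rw [slope_def_field, div_le_iff₀ (sub_pos.2 h)] at this
      linarith

lemma one_add_two_mul_exp_neg_le {w : ℝ} (hw : 1 ≤ w) :
    (1 + 2 * w) * Real.exp (-w) ≤ 3 / Real.exp 1 := by
  have h := Real.add_one_le_exp (w - 1)
  rw [Real.exp_sub, le_div_iff₀ (Real.exp_pos 1)] at h
  rw [Real.exp_neg, ← div_eq_mul_inv, div_le_div_iff₀ (Real.exp_pos w) (Real.exp_pos 1)]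
  nlinarith [Real.exp_pos 1]

lemma convexOn_of_forall_exists_support {D : Set ℝ} (hD : Convex ℝ D) {f : ℝ → ℝ}
    (h : ∀ y ∈ D, ∃ c, ∀ z ∈ D, f y + c * (z - y) ≤ f z) : ConvexOn ℝ D f := by
  refine ⟨hD, fun x hx z hz a b ha hb hab => ?_⟩
  obtain ⟨c, hc⟩ := h _ (hD hx hz ha hb hab)
  have h1 := mul_le_mul_of_nonneg_left (hc x hx) ha
  have h2 := mul_le_mul_of_nonneg_left (hc z hz) hb
  simp only [smul_eq_mul] at *
  have : a * (f (a * x + b * z) + c * (x - (a * x + b * z)))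
    + b * (f (a * x + b * z) + c * (z - (a * x + b * z)))
    = (a + b) * f (a * x + b * z) + c * ((a * x + b * z) - (a + b) * (a * x + b * z)) := by ring
  rw [hab] at this
  linarith

/-! ### The Orlicz function of a vector -/

lemma vecOrlicz_of_l2Norm_eq_zero {n : ℕ} {x : Fin n → ℝ} (hx : l2Norm x = 0) {s : ℝ}
    (hs : 0 ≤ s) : vecOrlicz x s = 0 := by
  have : ¬ s < 0 := not_lt.2 hs
  simp [vecOrlicz, hx, this]

lemma vecOrlicz_of_le {n : ℕ} {x : Fin n → ℝ} (hx : 0 < l2Norm x) {s : ℝ}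
    (hs : s ≤ 1 / l2Norm x) :
    vecOrlicz x s = (s * maxAbs x) * Real.exp (-(1 / (s * maxAbs x) ^ 2)) := by
  rcases hs.lt_or_eq with h | rfl
  · rw [vecOrlicz, if_pos h, mul_pow]
  · rw [vecOrlicz, if_neg (lt_irrefl _), sub_self, mul_zero, add_zero]
    have := maxAbs_pos hx
    congr 2
    · field_simp
    · field_simp

lemma vecOrlicz_of_ge {n : ℕ} {x : Fin n → ℝ} {s : ℝ} (hs : 1 / l2Norm x ≤ s) :
    vecOrlicz x s = vecOrlicz x (1 / l2Norm x)
      + 3 / Real.exp 1 * l2Norm x * (s - 1 / l2Norm x) := by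
  simp only [vecOrlicz, if_neg (not_lt.2 hs), if_neg (lt_irrefl _), sub_self, mul_zero, add_zero]

lemma vecOrlicz_zero {n : ℕ} (x : Fin n → ℝ) : vecOrlicz x 0 = 0 := by
  rcases (l2Norm_nonneg x).eq_or_lt with h | h
  · exact vecOrlicz_of_l2Norm_eq_zero h.symm le_rfl
  · rw [vecOrlicz_of_le h (by positivity)]; simp

lemma vecOrlicz_nonneg {n : ℕ} (x : Fin n → ℝ) {s : ℝ} (hs : 0 ≤ s) : 0 ≤ vecOrlicz x s := by
  have hm := maxAbs_nonneg x
  have hl := l2Norm_nonneg x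
  unfold vecOrlicz
  split_ifs with h
  · positivity
  · have : 0 ≤ s - 1 / l2Norm x := by linarith
    positivity

lemma isOrliczFunction_vecOrlicz {n : ℕ} (x : Fin n → ℝ) : IsOrliczFunction (vecOrlicz x) := by
  refine ⟨fun s hs => vecOrlicz_nonneg x hs, vecOrlicz_zero x, ?_⟩
  refine convexOn_of_forall_exists_support (convex_Ici 0) fun y hy => ?_
  rcases (l2Norm_nonneg x).eq_or_lt with h | hL
  · refine ⟨0, fun z hz => ?_⟩
    rw [vecOrlicz_of_l2Norm_eq_zero h.symm hy, vecOrlicz_of_l2Norm_eq_zero h.symm hz]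
    simp
  have hm := maxAbs_pos hL
  have hmL := maxAbs_le_l2Norm x
  rcases (Set.mem_Ici.1 hy).eq_or_lt with rfl | hy0
  · refine ⟨0, fun z hz => ?_⟩
    rw [vecOrlicz_zero]
    simpa using vecOrlicz_nonneg x hz
  set L := l2Norm x with hLdef
  set m := maxAbs x with hmdef
  have hscale : ∀ s, s ≤ 1 / L → s * m ≤ 1 := fun s hs =>
    calc s * m ≤ 1 / L * m := by gcongr
      _ ≤ 1 := by rw [one_div_mul_eq_div, div_le_one hL]; exact hmL
  let d : ℝ → ℝ := fun s => m * ((1 + 2 / (s * m) ^ 2) * Real.exp (-(1 / (s * m) ^ 2)))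
  have htan : ∀ s z, 0 < s → s ≤ 1 / L → 0 ≤ z → z ≤ 1 / L →
      vecOrlicz x s + d s * (z - s) ≤ vecOrlicz x z := by
    intro s z hs hs1 hz hz1
    have := tangent_le_mul_exp_neg_one_div_sq (mul_pos hs hm) (hscale s hs1)
      (mul_nonneg hz hm.le) (hscale z hz1)
    rw [vecOrlicz_of_le hL hs1, vecOrlicz_of_le hL hz1]
    calc _ = _ := by simp only [d]; ring
      _ ≤ _ := this
  -- The slope can only jump up at the knee `1 / L`, so supporting lines survive gluing; `3/e` is
  -- the value of `(1 + 2w) exp(-w)` at `w = 1`.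
  have hd : ∀ s, 0 < s → s ≤ 1 / L → d s ≤ 3 / Real.exp 1 * L := by
    intro s hs hs1
    have hw : 1 ≤ 1 / (s * m) ^ 2 := by
      rw [le_div_iff₀ (by positivity), one_mul]
      exact pow_le_one₀ (by positivity) (hscale s hs1)
    have := one_add_two_mul_exp_neg_le hw
    calc d s = m * ((1 + 2 * (1 / (s * m) ^ 2)) * Real.exp (-(1 / (s * m) ^ 2))) := by
          simp only [d]; ring
      _ ≤ L * (3 / Real.exp 1) := by gcongr
      _ = _ := mul_comm _ _
  have hr : 0 < 1 / L := by positivity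
  rcases le_or_gt y (1 / L) with hyr | hyr
  · refine ⟨d y, fun z hz => ?_⟩
    rcases le_or_gt z (1 / L) with hzr | hzr
    · exact htan y z hy0 hyr hz hzr
    · rw [vecOrlicz_of_ge hzr.le]
      have h1 := htan y (1 / L) hy0 hyr hr.le le_rfl
      have h2 := mul_le_mul_of_nonneg_right (hd y hy0 hyr) (sub_nonneg.2 hzr.le)
      simp only [← hLdef] at *
      linarith
  · refine ⟨3 / Real.exp 1 * L, fun z hz => ?_⟩
    rw [vecOrlicz_of_ge hyr.le]
    rcases le_or_gt z (1 / L) with hzr | hzr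
    · have h1 := htan (1 / L) z hr le_rfl hz hzr
      have h2 := mul_le_mul_of_nonneg_right (hd _ hr le_rfl) (sub_nonneg.2 hzr)
      simp only [← hLdef] at *
      linarith
    · rw [vecOrlicz_of_ge hzr.le]
      simp only [← hLdef] at *
      linarith

lemma IsOrliczFunction.mono {M : ℝ → ℝ} (hM : IsOrliczFunction M) {s t : ℝ} (hs : 0 ≤ s)
    (hst : s ≤ t) : M s ≤ M t := by
  rcases (hs.trans hst).eq_or_lt with rfl | ht
  · rw [le_antisymm hst hs]
  have h1 : s / t ≤ 1 := div_le_one_of_le₀ hst ht.le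
  have h := hM.convexOn.2 (Set.mem_Ici.2 ht.le) (Set.mem_Ici.2 le_rfl)
    (div_nonneg hs ht.le) (sub_nonneg.2 h1) (by ring)
  simp only [smul_eq_mul, mul_zero, add_zero, hM.map_zero, div_mul_cancel₀ _ ht.ne'] at h
  exact h.trans (mul_le_of_le_one_left (hM.nonneg t ht.le) h1)

lemma vecOrlicz_one_div {n : ℕ} {x : Fin n → ℝ} {t : ℝ} (ht : 0 < t) (h : l2Norm x ≤ t) :
    vecOrlicz x (1 / t) = maxAbs x / t * Real.exp (-(t ^ 2 / maxAbs x ^ 2)) := by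
  rcases (l2Norm_nonneg x).eq_or_lt with h0 | h0
  · rw [vecOrlicz_of_l2Norm_eq_zero h0.symm (by positivity),
      le_antisymm ((maxAbs_le_l2Norm x).trans h0.symm.le) (maxAbs_nonneg x)]
    simp
  · have := maxAbs_pos h0
    rw [vecOrlicz_of_le h0 (one_div_le_one_div_of_le h0 h)]
    congr 1
    · field_simp
    · congr 1
      field_simp

/-- Beyond the knee the slope is at least `l2Norm x`, since `3/e ≥ 1`; hence the value at `1/t` is
at least `l2Norm x / t - 1`. -/
lemma l2Norm_le_two_mul_of_vecOrlicz_le_one {n : ℕ} {x : Fin n → ℝ} {t : ℝ} (ht : 0 < t)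
    (h : vecOrlicz x (1 / t) ≤ 1) : l2Norm x ≤ 2 * t := by
  rcases le_or_gt (l2Norm x) t with h1 | h1
  · linarith
  have hL : 0 < l2Norm x := ht.trans h1
  rw [vecOrlicz_of_ge (one_div_le_one_div_of_le ht h1.le)] at h
  have h0 := vecOrlicz_nonneg x (one_div_nonneg.2 hL.le)
  have he : 1 ≤ 3 / Real.exp 1 := by
    rw [le_div_iff₀ (Real.exp_pos 1)]; linarith [Real.exp_one_lt_d9]
  have h2 : 3 / Real.exp 1 * l2Norm x * (1 / t - 1 / l2Norm x)
      = 3 / Real.exp 1 * (l2Norm x / t - 1) := by field_simp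
  have h3 : 0 ≤ l2Norm x / t - 1 := by rw [sub_nonneg, le_div_iff₀ ht]; linarith
  have h4 : l2Norm x / t ≤ 2 := by nlinarith
  rwa [div_le_iff₀ ht] at h4

/-! ### Gaussian tails and exponential moments -/

/-- A constant for the Gaussian tail bound `c * (1 / u * e^{-u²}) ≤ ℙ(u < |g|)`, `u ≥ 1`. -/
noncomputable def gaussianTailConst : ℝ := (√(2 * Real.pi))⁻¹ * Real.exp (-(3 / 2))

lemma gaussianTailConst_pos : 0 < gaussianTailConst := by
  unfold gaussianTailConst; positivity

lemma gaussianTailConst_le_measureReal {u : ℝ} (hu : 1 ≤ u) :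
    gaussianTailConst * (1 / u * Real.exp (-u ^ 2)) ≤ (gaussianReal 0 1).real {x | u < |x|} := by
  have hu0 : 0 < u := by linarith
  -- On this interval of length `1/u`, `x²/2 ≤ (u² + 3)/2 ≤ u² + 3/2`.
  have hsub : Set.Ioc u (u + 1 / u) ⊆ {x | u < |x|} := fun x hx => hx.1.trans_le (le_abs_self x)
  refine le_trans ?_ (measureReal_mono hsub)
  rw [measureReal_def, gaussianReal_apply_eq_integral _ one_ne_zero,
    ENNReal.toReal_ofReal (integral_nonneg fun x => gaussianPDFReal_nonneg _ _ _)]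
  have hlb : ∀ x ∈ Set.Ioc u (u + 1 / u),
      gaussianTailConst * Real.exp (-u ^ 2) ≤ gaussianPDFReal 0 1 x := by
    intro x hx
    rw [gaussianPDFReal_def, gaussianTailConst]
    simp only [NNReal.coe_one, mul_one, sub_zero]
    rw [mul_assoc, ← Real.exp_add]
    gcongr
    have h1 : x ^ 2 ≤ (u + 1 / u) ^ 2 := pow_le_pow_left₀ (hu0.le.trans hx.1.le) hx.2 2
    have h2 : (u + 1 / u) ^ 2 = u ^ 2 + 2 + (1 / u) ^ 2 := by field_simp; ring
    have h3 : (1 / u) ^ 2 ≤ 1 := pow_le_one₀ (by positivity) ((div_le_one hu0).2 hu)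
    nlinarith
  calc gaussianTailConst * (1 / u * Real.exp (-u ^ 2))
      = ∫ x in Set.Ioc u (u + 1 / u), gaussianTailConst * Real.exp (-u ^ 2) := by
        rw [setIntegral_const, measureReal_def, Real.volume_Ioc, add_sub_cancel_left,
          ENNReal.toReal_ofReal (by positivity), smul_eq_mul]
        ring
    _ ≤ _ := by
        refine setIntegral_mono_on ?_ (integrable_gaussianPDFReal 0 1).integrableOn
          measurableSet_Ioc hlb
        exact integrableOn_const (by simp)

lemma integral_exp_mul_sq_gaussianReal {b : ℝ} (hb : b < 1 / 2) :
    ∫ x, Real.exp (b * x ^ 2) ∂(gaussianReal 0 1) = √((1 - 2 * b)⁻¹) := by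
  rw [integral_gaussianReal_eq_integral_smul one_ne_zero]
  have h : ∀ x, gaussianPDFReal 0 1 x • Real.exp (b * x ^ 2)
      = (√(2 * Real.pi))⁻¹ * Real.exp (-(1 / 2 - b) * x ^ 2) := by
    intro x
    rw [gaussianPDFReal_def]
    simp only [NNReal.coe_one, mul_one, sub_zero, smul_eq_mul]
    rw [mul_assoc, ← Real.exp_add]
    congr 2
    ring
  simp_rw [h]
  rw [integral_const_mul, integral_gaussian, ← Real.sqrt_inv, ← Real.sqrt_mul (by positivity)]
  congr 1
  have : (0 : ℝ) < 1 / 2 - b := by linarith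
  have : (0 : ℝ) < 1 - 2 * b := by linarith
  have := Real.pi_pos
  field_simp

lemma sqrt_inv_one_sub_le_exp {y : ℝ} (hy0 : 0 ≤ y) (hy : y ≤ 1 / 2) :
    √((1 - y)⁻¹) ≤ Real.exp y := by
  rw [Real.sqrt_le_left (Real.exp_pos y).le, ← Real.exp_nat_mul]
  have h := Real.add_one_le_exp (((2 : ℕ) : ℝ) * y)
  push_cast at h ⊢
  refine le_trans ?_ h
  rw [inv_le_iff_one_le_mul₀ (by linarith)]
  nlinarith

section

variable {Ω : Type*} [MeasurableSpace Ω] {P : Measure Ω} {n : ℕ}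

lemma integrable_abs_of_hasLaw_gaussianReal {X : Ω → ℝ} (hX : HasLaw X (gaussianReal 0 1) P) :
    Integrable (fun ω => |X ω|) P := by
  have h : Integrable (fun x : ℝ => |x|) (gaussianReal 0 1) :=
    ((memLp_id_gaussianReal 1).integrable le_rfl).abs
  rw [← hX.map_eq] at h
  exact h.comp_aemeasurable hX.aemeasurable

lemma gaussianTailConst_le_integral_abs [IsProbabilityMeasure P] {X : Ω → ℝ}
    (hX : HasLaw X (gaussianReal 0 1) P) :
    gaussianTailConst * Real.exp (-1) ≤ ∫ ω, |X ω| ∂P := by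
  have h := gaussianTailConst_le_measureReal le_rfl
  norm_num at h
  have hms : MeasurableSet {x : ℝ | 1 < |x|} := measurableSet_lt measurable_const measurable_abs
  rw [← hX.measureReal_eq hms] at h
  have h2 := mul_meas_ge_le_integral_of_nonneg (ae_of_all P fun ω => abs_nonneg (X ω))
    (integrable_abs_of_hasLaw_gaussianReal hX) 1
  rw [one_mul] at h2
  have h3 : P.real {ω | 1 < |X ω|} ≤ P.real {ω | 1 ≤ |X ω|} :=
    measureReal_mono (Set.ofPred_subset_ofPred.2 fun ω hω => le_of_lt hω)
  exact h.trans (h3.trans h2)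

/-- Independence factors the moment. The scale `4 m²` keeps each exponent coefficient at most `1/4`,
below the critical `1/2`. -/
lemma integral_exp_sq_row_le {a : Fin n → ℝ} {g : Fin n → Ω → ℝ}
    (hg : ∀ j, HasLaw (g j) (gaussianReal 0 1) P) (hind : iIndepFun g P) (hm : 0 < maxAbs a) :
    Integrable (fun ω => Real.exp (l2Norm (fun j => a j * g j ω) ^ 2 / (4 * maxAbs a ^ 2))) P ∧
    ∫ ω, Real.exp (l2Norm (fun j => a j * g j ω) ^ 2 / (4 * maxAbs a ^ 2)) ∂P
      ≤ Real.exp (l2Norm a ^ 2 / (2 * maxAbs a ^ 2)) := by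
  set m := maxAbs a with hmdef
  have hX : iIndepFun (fun j ω => (a j * g j ω) ^ 2) P :=
    hind.comp (fun j x => (a j * x) ^ 2) fun j => by fun_prop
  have hXm : ∀ j, AEMeasurable (fun ω => (a j * g j ω) ^ 2) P := fun j =>
    ((hg j).aemeasurable.const_mul _).pow_const 2
  have h := hX.mgf_sum₀ (t := 1 / (4 * m ^ 2)) hXm Finset.univ
  have hb : ∀ j, a j ^ 2 / (4 * m ^ 2) ≤ 1 / 4 := fun j => by
    rw [div_le_iff₀ (by positivity)]
    have := sq_le_sq' (by linarith [abs_nonneg (a j)]) (abs_le_maxAbs a j)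
    rw [sq_abs] at this
    linarith
  have hj : ∀ j, mgf (fun ω => (a j * g j ω) ^ 2) P (1 / (4 * m ^ 2))
      = √((1 - 2 * (a j ^ 2 / (4 * m ^ 2)))⁻¹) := fun j => by
    rw [← integral_exp_mul_sq_gaussianReal (by linarith [hb j]), ← (hg j).integral_comp
      (by fun_prop), mgf]
    refine integral_congr_ae (ae_of_all _ fun ω => ?_)
    simp only [Function.comp]
    congr 1
    ring
  have hfun : (fun ω => Real.exp (1 / (4 * m ^ 2) * (∑ j, fun ω => (a j * g j ω) ^ 2) ω))
      = fun ω => Real.exp (l2Norm (fun j => a j * g j ω) ^ 2 / (4 * m ^ 2)) := by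
    ext ω
    rw [l2Norm_sq, Finset.sum_apply, one_div_mul_eq_div]
  simp_rw [hj] at h
  rw [mgf, hfun] at h
  refine ⟨?_, ?_⟩
  -- A non-integrable function has integral `0` by convention, but the product is positive.
  · by_contra hni
    rw [integral_undef hni] at h
    refine (Finset.prod_pos fun j _ => ?_).ne h
    have := hb j
    exact Real.sqrt_pos.2 (inv_pos.2 (by linarith))
  · rw [h, l2Norm_sq, Finset.sum_div, Real.exp_sum]
    refine Finset.prod_le_prod (fun j _ => Real.sqrt_nonneg _) fun j _ => ?_
    have h2 : a j ^ 2 / (2 * m ^ 2) = 2 * (a j ^ 2 / (4 * m ^ 2)) := by field_simp; norm_num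
    rw [h2]
    exact sqrt_inv_one_sub_le_exp (by positivity) (by linarith [hb j])

/-- Above the level `3 T`, the exponential of `y² / (4 m²)` dominates linear growth. -/
lemma sub_le_mul_exp_sq {y m T : ℝ} (hm : 0 < m) (hT : 0 < T) :
    y - 3 * T ≤ m ^ 2 / T * Real.exp (-(9 * T ^ 2 / (4 * m ^ 2)))
      * Real.exp (y ^ 2 / (4 * m ^ 2)) := by
  rcases le_or_gt y (3 * T) with h | h
  · have : 0 ≤ m ^ 2 / T * Real.exp (-(9 * T ^ 2 / (4 * m ^ 2)))
      * Real.exp (y ^ 2 / (4 * m ^ 2)) := by positivity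
    linarith
  -- Factor `y² - 9T² = (y - 3T)(y + 3T)` and use `y + 3T ≥ 4T`.
  have hv : (y - 3 * T) * T / m ^ 2 ≤ (y ^ 2 - 9 * T ^ 2) / (4 * m ^ 2) := by
    rw [div_le_div_iff₀ (by positivity) (by positivity)]
    have : (y - 3 * T) * T * 4 ≤ y ^ 2 - 9 * T ^ 2 := by nlinarith
    nlinarith [sq_nonneg m]
  have he := Real.add_one_le_exp ((y ^ 2 - 9 * T ^ 2) / (4 * m ^ 2))
  rw [mul_assoc, ← Real.exp_add]
  have : -(9 * T ^ 2 / (4 * m ^ 2)) + y ^ 2 / (4 * m ^ 2) = (y ^ 2 - 9 * T ^ 2) / (4 * m ^ 2) := by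
    ring
  rw [this]
  calc y - 3 * T = m ^ 2 / T * ((y - 3 * T) * T / m ^ 2) := by field_simp
    _ ≤ _ := by gcongr; linarith

lemma aemeasurable_l2Norm {f : Fin n → Ω → ℝ} (hf : ∀ j, AEMeasurable (f j) P) :
    AEMeasurable (fun ω => l2Norm fun j => f j ω) P := by
  simp_rw [l2Norm_eq_sqrt]
  exact (Finset.aemeasurable_fun_sum _ fun j _ => (hf j).pow_const 2).sqrt

lemma l2Norm_le_sum_abs (x : Fin n → ℝ) : l2Norm x ≤ ∑ j, |x j| := by
  rw [l2Norm_eq_sqrt]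
  refine Real.sqrt_le_left (Finset.sum_nonneg fun j _ => abs_nonneg _) |>.2 ?_
  simp_rw [← sq_abs (x _)]
  exact Finset.sum_sq_le_sq_sum_of_nonneg fun j _ => abs_nonneg _

lemma integrable_l2Norm {f : Fin n → Ω → ℝ} (hf : ∀ j, Integrable (f j) P) :
    Integrable (fun ω => l2Norm fun j => f j ω) P := by
  refine (integrable_finsetSum Finset.univ fun j _ => (hf j).abs).mono'
    (aemeasurable_l2Norm fun j => (hf j).aemeasurable).aestronglyMeasurable
    (ae_of_all _ fun ω => ?_)
  rw [Real.norm_of_nonneg (l2Norm_nonneg _)]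
  exact l2Norm_le_sum_abs _

lemma integrable_iSup {Y : Fin n → Ω → ℝ} (hY : ∀ i, Integrable (Y i) P) (h0 : ∀ i ω, 0 ≤ Y i ω) :
    Integrable (fun ω => ⨆ i, Y i ω) P := by
  refine (integrable_finsetSum Finset.univ fun i _ => hY i).mono'
    (AEMeasurable.iSup fun i => (hY i).aemeasurable).aestronglyMeasurable
    (ae_of_all _ fun ω => ?_)
  rw [Real.norm_of_nonneg (Real.iSup_nonneg fun i => h0 i ω)]
  refine Real.iSup_le (fun i => ?_) (Finset.sum_nonneg fun i _ => h0 i ω)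
  exact Finset.single_le_sum (f := fun i => Y i ω) (fun i _ => h0 i ω) (Finset.mem_univ i)

end

/-! ### Upper bound for the maximal row norm -/

section

variable {Ω : Type*} [MeasurableSpace Ω] {P : Measure Ω} {n : ℕ}
  {a : Fin n → Fin n → ℝ} {g : Fin n → Fin n → Ω → ℝ}

lemma integrable_l2Norm_row {a : Fin n → ℝ} {g : Fin n → Ω → ℝ}
    (hg : ∀ j, HasLaw (g j) (gaussianReal 0 1) P) :
    Integrable (fun ω => l2Norm fun j => a j * g j ω) P :=
  integrable_l2Norm fun j => ((integrable_norm_iff (hg j).aemeasurable.aestronglyMeasurable).1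
    (integrable_abs_of_hasLaw_gaussianReal (hg j))).const_mul _

lemma integral_max_sub_le [IsProbabilityMeasure P] {a : Fin n → ℝ} {g : Fin n → Ω → ℝ}
    (hg : ∀ j, HasLaw (g j) (gaussianReal 0 1) P) (hind : iIndepFun g P) {T : ℝ} (hT : 0 < T)
    (haT : l2Norm a ≤ T) :
    ∫ ω, max (l2Norm (fun j => a j * g j ω) - 3 * T) 0 ∂P ≤ T * vecOrlicz a (1 / T) := by
  rw [vecOrlicz_one_div hT haT]
  rcases (maxAbs_nonneg a).eq_or_lt with h0 | hm
  · have : a = 0 := by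
      ext j
      simpa [← h0] using abs_le_maxAbs a j
    subst this
    have : ∀ ω, max (l2Norm (fun j => (0 : Fin n → ℝ) j * g j ω) - 3 * T) 0 = 0 := fun ω => by
      have : l2Norm (fun j => (0 : Fin n → ℝ) j * g j ω) = 0 := by simp [l2Norm_eq_sqrt]
      rw [this, max_eq_right]
      linarith
    simp_rw [this]
    simp [← h0]
  set m := maxAbs a with hmdef
  obtain ⟨hint, hle⟩ := integral_exp_sq_row_le hg hind hm
  set K := m ^ 2 / T * Real.exp (-(9 * T ^ 2 / (4 * m ^ 2))) with hK
  have hmT : m ≤ T := (maxAbs_le_l2Norm a).trans haT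
  calc ∫ ω, max (l2Norm (fun j => a j * g j ω) - 3 * T) 0 ∂P
      ≤ ∫ ω, K * Real.exp (l2Norm (fun j => a j * g j ω) ^ 2 / (4 * m ^ 2)) ∂P := by
        refine integral_mono ?_ (hint.const_mul _) fun ω => ?_
        · exact ((integrable_l2Norm_row hg).sub (integrable_const _)).pos_part
        · exact max_le (sub_le_mul_exp_sq hm hT) (by positivity)
    _ ≤ K * Real.exp (T ^ 2 / (2 * m ^ 2)) := by
        rw [integral_const_mul]
        have := l2Norm_nonneg a
        refine mul_le_mul_of_nonneg_left (hle.trans ?_) (by positivity)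
        gcongr
    _ ≤ T * (m / T * Real.exp (-(T ^ 2 / m ^ 2))) := by
        rw [hK, mul_assoc, ← Real.exp_add, ← mul_assoc, mul_div_cancel₀ _ hT.ne']
        refine mul_le_mul ?_ ?_ (Real.exp_pos _).le hm.le
        · rw [div_le_iff₀ hT]; nlinarith
        -- The level `3T` gives the coefficient `-9/4 + 1/2 = -7/4`, below the required `-1`.
        · refine Real.exp_le_exp.2 ?_
          have : -(9 * T ^ 2 / (4 * m ^ 2)) + T ^ 2 / (2 * m ^ 2)
            = -(T ^ 2 / m ^ 2) - 3 / 4 * (T ^ 2 / m ^ 2) := by ring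
          rw [this]
          have : 0 ≤ T ^ 2 / m ^ 2 := by positivity
          linarith

/-- Needed because `sInf ∅ = 0` would defeat the upper bound. The `1` in the witness keeps it
positive when all rows vanish. -/
lemma musielakOrlicz_set_nonempty (a : Fin n → Fin n → ℝ) :
    {t : ℝ | 0 < t ∧ ∑ i, rowOrlicz a i (|1| / t) ≤ 1}.Nonempty := by
  set S := ∑ i, l2Norm (a i) with hS
  have hS0 : 0 ≤ S := Finset.sum_nonneg fun i _ => l2Norm_nonneg _
  have ht : 0 < 1 + S := by linarith
  refine ⟨1 + S, ht, ?_⟩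
  have hle : ∀ i, l2Norm (a i) ≤ 1 + S := fun i => by
    have := Finset.single_le_sum (f := fun i => l2Norm (a i)) (fun i _ => l2Norm_nonneg _)
      (Finset.mem_univ i)
    simp only [← hS] at this
    linarith
  calc ∑ i, rowOrlicz a i (|1| / (1 + S)) ≤ ∑ i, l2Norm (a i) / (1 + S) := by
        refine Finset.sum_le_sum fun i _ => ?_
        rw [abs_one, rowOrlicz, vecOrlicz_one_div ht (hle i)]
        have h1 : maxAbs (a i) / (1 + S) ≤ l2Norm (a i) / (1 + S) := by
          gcongr; exact maxAbs_le_l2Norm _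
        refine (mul_le_of_le_one_right (div_nonneg (maxAbs_nonneg _) ht.le) ?_).trans h1
        rw [Real.exp_le_one_iff, neg_nonpos]
        positivity
    _ ≤ 1 := by
        rw [← Finset.sum_div, ← hS, div_le_one ht]
        linarith

lemma iIndepFun_row (hind : iIndepFun (fun p : Fin n × Fin n => g p.1 p.2) P) (i : Fin n) :
    iIndepFun (g i) P :=
  hind.precomp (g := fun j => (i, j)) (Prod.mk_right_injective i)

lemma integrable_iSup_l2Norm_row (a : Fin n → Fin n → ℝ)
    (hg : ∀ i j, HasLaw (g i j) (gaussianReal 0 1) P) :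
    Integrable (fun ω => ⨆ i, l2Norm fun j => a i j * g i j ω) P :=
  integrable_iSup (fun i => integrable_l2Norm_row (hg i)) fun _ _ => l2Norm_nonneg _

lemma integral_iSup_l2Norm_row_le [IsProbabilityMeasure P] (a : Fin n → Fin n → ℝ)
    (hg : ∀ i j, HasLaw (g i j) (gaussianReal 0 1) P)
    (hind : iIndepFun (fun p : Fin n × Fin n => g p.1 p.2) P) :
    ∫ ω, (⨆ i, l2Norm fun j => a i j * g i j ω) ∂P
      ≤ 8 * musielakOrliczNorm (rowOrlicz a) fun _ => 1 := by
  have hkey : ∀ t ∈ {t : ℝ | 0 < t ∧ ∑ i, rowOrlicz a i (|1| / t) ≤ 1},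
      (∫ ω, (⨆ i, l2Norm fun j => a i j * g i j ω) ∂P) / 8 ≤ t := by
    rintro t ⟨ht, hsum⟩
    rw [abs_one] at hsum
    have hO : ∀ i, IsOrliczFunction (rowOrlicz a i) := fun i => isOrliczFunction_vecOrlicz _
    have h1 : ∀ i, l2Norm (a i) ≤ 2 * t := fun i =>
      l2Norm_le_two_mul_of_vecOrlicz_le_one ht <| (Finset.single_le_sum
        (f := fun i => rowOrlicz a i (1 / t)) (fun i _ => (hO i).nonneg _ (by positivity))
        (Finset.mem_univ i)).trans hsum
    have hT : 0 < 2 * t := by linarith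
    have hsumT : ∑ i, rowOrlicz a i (1 / (2 * t)) ≤ 1 := by
      refine le_trans (Finset.sum_le_sum fun i _ => (hO i).mono (by positivity) ?_) hsum
      exact one_div_le_one_div_of_le ht (by linarith)
    have hint : ∀ i, Integrable
        (fun ω => max (l2Norm (fun j => a i j * g i j ω) - 3 * (2 * t)) 0) P := fun i =>
      ((integrable_l2Norm_row (hg i)).sub (integrable_const _)).pos_part
    have : ∫ ω, (⨆ i, l2Norm fun j => a i j * g i j ω) ∂P ≤ 8 * t := by
      calc _ ≤ ∫ ω, (3 * (2 * t)
            + ∑ i, max (l2Norm (fun j => a i j * g i j ω) - 3 * (2 * t)) 0) ∂P := by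
            refine integral_mono (integrable_iSup_l2Norm_row a hg)
              ((integrable_const _).add (integrable_finsetSum _ fun i _ => hint i)) fun ω => ?_
            have h0 : ∀ i ∈ Finset.univ,
                0 ≤ max (l2Norm (fun j => a i j * g i j ω) - 3 * (2 * t)) 0 :=
              fun i _ => le_max_right _ _
            refine Real.iSup_le (fun i => ?_) (add_nonneg (by linarith) (Finset.sum_nonneg h0))
            have h2 := Finset.single_le_sum h0 (Finset.mem_univ i)
            have h3 := le_max_left (l2Norm (fun j => a i j * g i j ω) - 3 * (2 * t)) 0
            linarith
        _ = 3 * (2 * t)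
            + ∑ i, ∫ ω, max (l2Norm (fun j => a i j * g i j ω) - 3 * (2 * t)) 0 ∂P := by
            rw [integral_add (integrable_const _) (integrable_finsetSum _ fun i _ => hint i),
              integral_finsetSum _ fun i _ => hint i]
            simp
        _ ≤ 3 * (2 * t) + ∑ i, 2 * t * rowOrlicz a i (1 / (2 * t)) := by
            gcongr with i
            exact integral_max_sub_le (hg i) (iIndepFun_row hind i) hT (h1 i)
        _ ≤ 8 * t := by
            rw [← Finset.mul_sum]
            nlinarith
    linarith
  have := le_csInf (musielakOrlicz_set_nonempty a) hkey
  rw [musielakOrliczNorm]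
  linarith

/-! ### Lower bound for the maximal row norm -/

/-- Cauchy–Schwarz against `a` itself reduces the norm to the first absolute moments of the entries.
-/
lemma mul_l2Norm_le_integral [IsProbabilityMeasure P] {a : Fin n → ℝ} {g : Fin n → Ω → ℝ}
    (hg : ∀ j, HasLaw (g j) (gaussianReal 0 1) P) :
    gaussianTailConst * Real.exp (-1) * l2Norm a ≤ ∫ ω, l2Norm (fun j => a j * g j ω) ∂P := by
  rcases (l2Norm_nonneg a).eq_or_lt with h0 | h0
  · rw [← h0, mul_zero]
    exact integral_nonneg fun ω => l2Norm_nonneg _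
  refine le_of_mul_le_mul_right ?_ h0
  have hcs : ∀ ω, ∑ j, a j ^ 2 * |g j ω| ≤ l2Norm (fun j => a j * g j ω) * l2Norm a := by
    intro ω
    rw [l2Norm_eq_sqrt, l2Norm_eq_sqrt]
    refine le_trans (le_of_eq ?_) (le_trans
      (Real.sum_mul_le_sqrt_mul_sqrt Finset.univ (fun j => |a j * g j ω|) fun j => |a j|) ?_)
    · refine Finset.sum_congr rfl fun j _ => ?_
      rw [abs_mul, ← sq_abs]; ring
    · simp_rw [sq_abs]; rfl
  rw [← integral_mul_const]
  calc gaussianTailConst * Real.exp (-1) * l2Norm a * l2Norm a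
      = ∑ j, a j ^ 2 * (gaussianTailConst * Real.exp (-1)) := by
        rw [← Finset.sum_mul, ← l2Norm_sq]; ring
    _ ≤ ∑ j, a j ^ 2 * ∫ ω, |g j ω| ∂P := by
        gcongr with j
        exact gaussianTailConst_le_integral_abs (hg j)
    _ = ∫ ω, ∑ j, a j ^ 2 * |g j ω| ∂P := by
        rw [integral_finsetSum _ fun j _ =>
          (integrable_abs_of_hasLaw_gaussianReal (hg j)).const_mul _]
        simp_rw [integral_const_mul]
    _ ≤ _ := integral_mono (integrable_finsetSum _ fun j _ =>
          (integrable_abs_of_hasLaw_gaussianReal (hg j)).const_mul _)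
          ((integrable_l2Norm_row hg).mul_const _) hcs

/-- For independent variables, a lower bound on the sum of the tails gives one on the tail of the
maximum. -/
lemma one_sub_exp_neg_sum_le_measureReal [IsProbabilityMeasure P] {ι : Type*}
    [Fintype ι] {X : ι → Ω → ℝ}
    (hX : ∀ i, AEMeasurable (X i) P) (hind : iIndepFun X P) (t : ℝ) :
    1 - Real.exp (-∑ i, P.real {ω | t < |X i ω|}) ≤ P.real {ω | ∃ i, t < |X i ω|} := by
  have hms : MeasurableSet {x : ℝ | t < |x|} := measurableSet_lt measurable_const measurable_abs
  have hnull : ∀ i, NullMeasurableSet {ω | t < |X i ω|} P := fun i =>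
    (hX i).nullMeasurableSet_preimage hms
  have hcompl : {ω | ∃ i, t < |X i ω|}ᶜ = ⋂ i, X i ⁻¹' {x : ℝ | t < |x|}ᶜ := by
    ext ω; simp
  have hprod : P.real {ω | ∃ i, t < |X i ω|}ᶜ = ∏ i, (1 - P.real {ω | t < |X i ω|}) := by
    rw [hcompl, measureReal_def,
      hind.meas_iInter (fun i => ⟨_, hms.compl, rfl⟩), ENNReal.toReal_prod]
    refine Finset.prod_congr rfl fun i _ => ?_
    rw [← probReal_compl_eq_one_sub₀ (hnull i)]
    rfl
  have hn : NullMeasurableSet {ω | ∃ i, t < |X i ω|} P := by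
    rw [Set.ofPred_exists]
    exact NullMeasurableSet.iUnion hnull
  rw [probReal_compl_eq_one_sub₀ hn] at hprod
  have hle : ∏ i, (1 - P.real {ω | t < |X i ω|}) ≤ Real.exp (-∑ i, P.real {ω | t < |X i ω|}) := by
    rw [← Finset.sum_neg_distrib, Real.exp_sum]
    refine Finset.prod_le_prod (fun i _ => sub_nonneg.2 measureReal_le_one) fun i _ => ?_
    linarith [Real.add_one_le_exp (-P.real {ω | t < |X i ω|})]
  linarith

lemma musielakOrliczNorm_row_le [IsProbabilityMeasure P] (a : Fin n → Fin n → ℝ)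
    (hg : ∀ i j, HasLaw (g i j) (gaussianReal 0 1) P)
    (hind : iIndepFun (fun p : Fin n × Fin n => g p.1 p.2) P) :
    min (gaussianTailConst * Real.exp (-1)) (1 - Real.exp (-gaussianTailConst))
      * musielakOrliczNorm (rowOrlicz a) (fun _ => 1)
      ≤ ∫ ω, (⨆ i, l2Norm fun j => a i j * g i j ω) ∂P := by
  set R : Ω → ℝ := fun ω => ⨆ i, l2Norm fun j => a i j * g i j ω with hR
  have hRint : Integrable R P := integrable_iSup_l2Norm_row a hg
  have hR0 : ∀ ω, 0 ≤ R ω := fun ω => Real.iSup_nonneg fun i => l2Norm_nonneg _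
  have hrow : ∀ i ω, l2Norm (fun j => a i j * g i j ω) ≤ R ω := fun i ω =>
    le_ciSup (f := fun i => l2Norm fun j => a i j * g i j ω) (Set.finite_range _).bddAbove i
  set c₁ := gaussianTailConst * Real.exp (-1) with hc₁
  set c₂ := 1 - Real.exp (-gaussianTailConst) with hc₂
  have hc0 := gaussianTailConst_pos
  have hc₁0 : 0 < c₁ := by positivity
  have hc₂0 : 0 < c₂ := by rw [hc₂, sub_pos, Real.exp_lt_one_iff]; linarith
  have hc : 0 < min c₁ c₂ := lt_min hc₁0 hc₂0
  have hμ0 : 0 ≤ ∫ ω, R ω ∂P := integral_nonneg hR0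
  rw [mul_comm, ← le_div_iff₀ hc]
  -- It suffices that every `t` strictly above the quotient is admissible; strictness also gives `t
  -- > 0` when the expectation is `0`.
  refine le_of_forall_gt_imp_ge_of_dense fun t ht => ?_
  have ht0 : 0 < t := lt_of_le_of_lt (by positivity) ht
  rw [div_lt_iff₀ hc] at ht
  refine csInf_le ⟨0, fun s hs => hs.1.le⟩ ⟨ht0, ?_⟩
  have hL : ∀ i, l2Norm (a i) ≤ t := fun i => by
    have h1 := (mul_l2Norm_le_integral (a := a i) (hg i)).trans
      (integral_mono (integrable_l2Norm_row (hg i)) hRint (hrow i))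
    have h2 : t * min c₁ c₂ ≤ c₁ * t := by
      rw [mul_comm]; gcongr; exact min_le_left _ _
    exact le_of_mul_le_mul_left ((h1.trans ht.le).trans h2) hc₁0
  by_contra! hsum
  rw [abs_one] at hsum
  have hmax : ∀ i, ∃ j, |a i j| = maxAbs (a i) := fun i =>
    have : Nonempty (Fin n) := ⟨i⟩
    exists_abs_eq_maxAbs (a i)
  choose k hk using hmax
  -- One entry per row, so the positions are distinct and the variables independent.
  let X : Fin n → Ω → ℝ := fun i ω => a i (k i) * g i (k i) ω
  have hXm : ∀ i, AEMeasurable (X i) P := fun i => (hg i (k i)).aemeasurable.const_mul _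
  have hXind : iIndepFun X P :=
    (hind.precomp (g := fun i => (i, k i)) fun i j h => (Prod.ext_iff.1 h).1).comp
      (fun i x => a i (k i) * x) fun i => by fun_prop
  have htail : ∀ i, gaussianTailConst * rowOrlicz a i (1 / t) ≤ P.real {ω | t < |X i ω|} := by
    intro i
    rw [rowOrlicz, vecOrlicz_one_div ht0 (hL i)]
    rcases (maxAbs_nonneg (a i)).eq_or_lt with h0 | hm
    · rw [← h0]; simp
    · have hms : MeasurableSet {x : ℝ | t / maxAbs (a i) < |x|} :=
        measurableSet_lt measurable_const measurable_abs
      have h1 := gaussianTailConst_le_measureReal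
        ((one_le_div hm).2 ((maxAbs_le_l2Norm (a i)).trans (hL i)))
      rw [← (hg i (k i)).measureReal_eq hms, one_div_div, div_pow] at h1
      have h2 : {ω | t / maxAbs (a i) < |g i (k i) ω|} = {ω | t < |X i ω|} := by
        ext ω
        simp only [X, Set.mem_ofPred_eq, abs_mul, hk, div_lt_iff₀' hm]
      rwa [h2] at h1
  have h1 : c₂ ≤ P.real {ω | ∃ i, t < |X i ω|} := by
    refine le_trans ?_ (one_sub_exp_neg_sum_le_measureReal hXm hXind t)
    rw [hc₂]
    gcongr
    calc gaussianTailConst ≤ gaussianTailConst * ∑ i, rowOrlicz a i (1 / t) :=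
          le_mul_of_one_le_right hc0.le hsum.le
      _ ≤ _ := by rw [Finset.mul_sum]; exact Finset.sum_le_sum fun i _ => htail i
  have h2 : P.real {ω | ∃ i, t < |X i ω|} ≤ P.real {ω | t ≤ R ω} := by
    refine measureReal_mono (Set.ofPred_subset_ofPred.2 ?_)
    rintro ω ⟨i, hi⟩
    exact hi.le.trans ((abs_le_l2Norm (fun j => a i j * g i j ω) (k i)).trans (hrow i ω))
  have h3 := mul_meas_ge_le_integral_of_nonneg (ae_of_all P hR0) hRint t
  have h4 : t * min c₁ c₂ ≤ t * P.real {ω | t ≤ R ω} := by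
    gcongr
    exact (min_le_right _ _).trans (h1.trans h2)
  linarith

end

/-! ### Rows and columns combined -/

theorem theorem3p1 :
    ∃ c₁ c₂ : ℝ, 0 < c₁ ∧ 0 < c₂ ∧
      ∀ (n : ℕ) (a : Fin n → Fin n → ℝ)
        (Ω : Type*) [MeasurableSpace Ω] (P : Measure Ω) [IsProbabilityMeasure P]
        (g : Fin n → Fin n → Ω → ℝ),
        (∀ i j, HasLaw (g i j) (gaussianReal 0 1) P) →
        iIndepFun (fun (p : Fin n × Fin n) => g p.1 p.2) P →
        (∀ i, IsOrliczFunction (rowOrlicz a i)) ∧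
        (∀ j, IsOrliczFunction (colOrlicz a j)) ∧
        Integrable (fun ω => maxRowAddMaxCol fun i j => a i j * g i j ω) P ∧
        c₁ * (musielakOrliczNorm (rowOrlicz a) (fun _ => 1)
            + musielakOrliczNorm (colOrlicz a) (fun _ => 1))
          ≤ ∫ ω, maxRowAddMaxCol (fun i j => a i j * g i j ω) ∂P ∧
        ∫ ω, maxRowAddMaxCol (fun i j => a i j * g i j ω) ∂P
          ≤ c₂ * (musielakOrliczNorm (rowOrlicz a) (fun _ => 1)
            + musielakOrliczNorm (colOrlicz a) (fun _ => 1)) := by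
  have hc0 := gaussianTailConst_pos
  refine ⟨min (gaussianTailConst * Real.exp (-1)) (1 - Real.exp (-gaussianTailConst)), 8,
    lt_min (by positivity) ?_, by norm_num, ?_⟩
  · rw [sub_pos, Real.exp_lt_one_iff]; linarith
  intro n a Ω _ P _ g hg hind
  have hind' : iIndepFun (fun p : Fin n × Fin n => g p.2 p.1) P :=
    hind.precomp (g := Prod.swap) Prod.swap_injective
  have hg' : ∀ j i, HasLaw (g i j) (gaussianReal 0 1) P := fun j i => hg i j
  have hrow := integrable_iSup_l2Norm_row a hg
  have hcol := integrable_iSup_l2Norm_row (fun j i => a i j) hg'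
  have hadd : ∫ ω, maxRowAddMaxCol (fun i j => a i j * g i j ω) ∂P
      = (∫ ω, (⨆ i, l2Norm fun j => a i j * g i j ω) ∂P)
        + ∫ ω, (⨆ j, l2Norm fun i => a i j * g i j ω) ∂P := integral_add hrow hcol
  refine ⟨fun i => isOrliczFunction_vecOrlicz _, fun j => isOrliczFunction_vecOrlicz _,
    hrow.add hcol, ?_, ?_⟩
  · rw [hadd, mul_add]
    exact add_le_add (musielakOrliczNorm_row_le a hg hind)
      (musielakOrliczNorm_row_le (fun j i => a i j) hg' hind')
  · rw [hadd, mul_add]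
    exact add_le_add (integral_iSup_l2Norm_row_le a hg hind)
      (integral_iSup_l2Norm_row_le (fun j i => a i j) hg' hind')
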